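/- For $\theta$ in the upper half-plane $\mathbb{H}=\{\theta\in\mathbb{C}:\mathrm{Im}(\theta)>0\}$ let $$p_\theta(x)=\frac{\mathrm{Im}(\theta)}{\pi\,|x-\theta|^2},\qquad x\in\mathbb{R},$$ be the Cauchy density with location $\mathrm{Re}(\theta)$ and scale $\mathrm{Im}(\theta)$, and for $\theta_1,\theta_2\in\mathbb{H}$ let $$D_{\mathrm{KL}}(p_{\theta_1}:p_{\theta_2})=\int_{\mathbb{R}}p_{\theta_1}(x)\log\frac{p_{\theta_1}(x)}{p_{\theta_2}(x)}\,\mathrm{d}x$$ be the Kullback-Leibler divergence. This divergence is finite for all $\theta_1,\theta_2\in\mathbb{H}$. Moreover, for every real $\alpha$ with $0<\alpha\le 1$, the function $$(\theta_1,\theta_2)\mapsto D_{\mathrm{KL}}(p_{\theta_1}:p_{\theta_2})^{\alpha}$$ is a metric on $\mathbb{H}$ if and only if $\alpha\le 1/2$. -/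

import Mathlib

/-- The Cauchy distribution `p_θ` with complex parameter `θ = l + i s` in the upper half-plane:
the probability measure on `ℝ` with location `l = Re θ` and scale `s = Im θ > 0`. -/
noncomputable def cauchyLaw (θ : UpperHalfPlane) : MeasureTheory.Measure ℝ :=
  ProbabilityTheory.cauchyMeasure θ.re θ.im.toNNReal

/-- `p_θ` has Lebesgue density `x ↦ |Im θ| / (π |x - θ|²)`. -/
theorem cauchyLaw_eq_withDensity (θ : UpperHalfPlane) :
    cauchyLaw θ = MeasureTheory.volume.withDensity
      (fun x : ℝ => ENNReal.ofReal (|θ.im| / (Real.pi * ‖(x : ℂ) - (θ : ℂ)‖ ^ 2))) := by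
  have h0 : θ.im.toNNReal ≠ 0 := (Real.toNNReal_pos.2 θ.im_pos).ne'
  rw [cauchyLaw, ProbabilityTheory.cauchyMeasure_of_scale_ne_zero _ h0]
  congr 1
  funext x
  rw [ProbabilityTheory.cauchyPDF_def, ProbabilityTheory.cauchyPDFReal_def]
  congr 1
  have h1 : ‖(x : ℂ) - (θ : ℂ)‖ ^ 2 = (x - θ.re) ^ 2 + θ.im ^ 2 := by
    rw [← Complex.normSq_eq_norm_sq, Complex.normSq_apply]
    simp
    ring
  rw [h1, abs_of_pos θ.im_pos, div_eq_mul_inv, mul_inv]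
  rw [Real.coe_toNNReal _ θ.im_pos.le]
  ring

/-- The Kullback-Leibler divergence `D_KL(p_θ₁ : p_θ₂) = ∫ p_θ₁ log (p_θ₁ / p_θ₂)`, in `[0, ∞]`. -/
noncomputable def cauchyKL (θ₁ θ₂ : UpperHalfPlane) : ENNReal :=
  InformationTheory.klDiv (cauchyLaw θ₁) (cauchyLaw θ₂)

/-- `d` is a metric on `X`: it is the distance function of some metric space structure on `X`. -/
def IsMetricOn {X : Type*} (d : X → X → ℝ) : Prop :=
  ∃ m : MetricSpace X, ∀ x y : X, m.dist x y = d x y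

/-! In an angular coordinate `p_θ` becomes the uniform law on the unit circle, and `log |x - w|`
becomes a constant plus `log |z - a| - log |z - 1|` with `|a| ≤ 1`. Both logarithms have circle
average zero, so `∫ log |x - w| dp_θ = log |conj θ - w|` (`integral_log_norm_sub`). Hence the
divergence is finite and equals `2 log cosh (d / 2)`, with `d` the hyperbolic distance
(`toReal_cauchyKL`).

Since `log (cosh t) / t ^ 2` decreases, `√(log cosh)` is subadditive, and exponents `α ≤ 1 / 2`
preserve this. Near `0` the `α`-th power behaves like a constant times `d ^ (2 * α)`, so for `α > 1
/ 2` close, equally spaced points on a geodesic violate the triangle inequality. -/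

open MeasureTheory Set Real ComplexConjugate

/-! ### Change of variables from the line to the circle -/

/-- The map `t ↦ l + s tan (t / 2 - π / 2)`, from `(0, 2π)` onto `ℝ`, which carries the uniform
distribution of the angle to the Cauchy distribution. -/
noncomputable def cauchyAngle (θ : UpperHalfPlane) (t : ℝ) : ℝ :=
  θ.re + θ.im * tan (t / 2 - π / 2)

theorem half_sub_half_pi_mem {t : ℝ} (ht : t ∈ Ioo 0 (2 * π)) :
    t / 2 - π / 2 ∈ Ioo (-(π / 2)) (π / 2) :=
  ⟨by linarith [ht.1], by linarith [ht.2]⟩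

theorem injOn_cauchyAngle (θ : UpperHalfPlane) : InjOn (cauchyAngle θ) (Ioo 0 (2 * π)) := by
  intro a ha b hb hab
  have h1 : tan (a / 2 - π / 2) = tan (b / 2 - π / 2) :=
    mul_left_cancel₀ θ.im_pos.ne' (add_left_cancel hab)
  have h2 := injOn_tan (half_sub_half_pi_mem ha) (half_sub_half_pi_mem hb) h1
  linarith

theorem image_cauchyAngle (θ : UpperHalfPlane) : cauchyAngle θ '' Ioo 0 (2 * π) = univ := by
  refine eq_univ_of_forall fun x => ⟨2 * arctan ((x - θ.re) / θ.im) + π, ⟨?_, ?_⟩, ?_⟩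
  · linarith [neg_pi_div_two_lt_arctan ((x - θ.re) / θ.im)]
  · linarith [arctan_lt_pi_div_two ((x - θ.re) / θ.im)]
  · have h : (2 * arctan ((x - θ.re) / θ.im) + π) / 2 - π / 2 = arctan ((x - θ.re) / θ.im) := by
      ring
    rw [cauchyAngle, h, tan_arctan, mul_div_cancel₀ _ θ.im_pos.ne']
    ring

theorem hasDerivAt_cauchyAngle (θ : UpperHalfPlane) {t : ℝ} (ht : t ∈ Ioo 0 (2 * π)) :
    HasDerivAt (cauchyAngle θ) (θ.im * (1 / cos (t / 2 - π / 2) ^ 2 * (1 / 2))) t := by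
  have h1 : HasDerivAt (fun t : ℝ => t / 2 - π / 2) (1 / 2) t :=
    ((hasDerivAt_id t).div_const 2).sub_const _
  exact (((hasDerivAt_tan_of_mem_Ioo (half_sub_half_pi_mem ht)).comp t h1).const_mul
    θ.im).const_add θ.re

/-- The Cauchy density. -/
noncomputable def cauchyDensity (θ : UpperHalfPlane) (x : ℝ) : ℝ :=
  |θ.im| / (π * ‖(x : ℂ) - (θ : ℂ)‖ ^ 2)

theorem coe_sub_ne_zero (θ : UpperHalfPlane) (x : ℝ) : (x : ℂ) - (θ : ℂ) ≠ 0 := by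
  intro h
  have := congrArg Complex.im h
  simp at this
  exact θ.im_pos.ne' this

theorem cauchyDensity_pos (θ : UpperHalfPlane) (x : ℝ) : 0 < cauchyDensity θ x := by
  have h := norm_pos_iff.2 (coe_sub_ne_zero θ x)
  have := abs_pos.2 θ.im_pos.ne'
  unfold cauchyDensity
  positivity

theorem measurable_cauchyDensity (θ : UpperHalfPlane) : Measurable (cauchyDensity θ) := by
  unfold cauchyDensity
  fun_prop

theorem cauchyLaw_eq_withDensity_cauchyDensity (θ : UpperHalfPlane) :
    cauchyLaw θ = volume.withDensity fun x => ENNReal.ofReal (cauchyDensity θ x) :=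
  cauchyLaw_eq_withDensity θ

instance isProbabilityMeasure_cauchyLaw (θ : UpperHalfPlane) :
    IsProbabilityMeasure (cauchyLaw θ) := by
  unfold cauchyLaw
  infer_instance

theorem abs_deriv_mul_cauchyDensity (θ : UpperHalfPlane) {t : ℝ} (ht : t ∈ Ioo 0 (2 * π)) :
    |θ.im * (1 / cos (t / 2 - π / 2) ^ 2 * (1 / 2))| * cauchyDensity θ (cauchyAngle θ t)
      = (2 * π)⁻¹ := by
  have hc := cos_pos_of_mem_Ioo (half_sub_half_pi_mem ht)
  have hs := θ.im_pos
  rw [cauchyDensity, cauchyAngle]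
  generalize t / 2 - π / 2 = φ at hc ⊢
  have h1 : ‖((θ.re + θ.im * tan φ : ℝ) : ℂ) - (θ : ℂ)‖ ^ 2
      = θ.im ^ 2 * (1 / cos φ ^ 2) := by
    rw [← Complex.normSq_eq_norm_sq, Complex.normSq_apply]
    have h2 := sin_sq_add_cos_sq φ
    simp only [tan_eq_sin_div_cos, Complex.sub_re, Complex.sub_im,
      Complex.ofReal_re, Complex.ofReal_im, UpperHalfPlane.coe_re, UpperHalfPlane.coe_im]
    field_simp
    linear_combination θ.im ^ 2 * h2
  have hp := pi_pos
  rw [h1, abs_of_pos (by positivity), abs_of_pos hs]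
  field_simp

theorem integrable_cauchyLaw_iff (θ : UpperHalfPlane) (g : ℝ → ℝ) :
    Integrable g (cauchyLaw θ) ↔
      IntegrableOn (fun t => g (cauchyAngle θ t)) (Ioo 0 (2 * π)) := by
  rw [cauchyLaw_eq_withDensity_cauchyDensity, integrable_withDensity_iff_integrable_smul'
    (measurable_cauchyDensity θ).ennreal_ofReal (by simp), ← integrableOn_univ,
    ← image_cauchyAngle θ, integrableOn_image_iff_integrableOn_abs_deriv_smul measurableSet_Ioo
      (fun t ht => (hasDerivAt_cauchyAngle θ ht).hasDerivWithinAt) (injOn_cauchyAngle θ)]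
  have h : EqOn (fun t => |θ.im * (1 / cos (t / 2 - π / 2) ^ 2 * (1 / 2))| •
      (ENNReal.ofReal (cauchyDensity θ (cauchyAngle θ t))).toReal • g (cauchyAngle θ t))
      (fun t => (2 * π)⁻¹ • g (cauchyAngle θ t)) (Ioo 0 (2 * π)) := by
    intro t ht
    simp only
    rw [ENNReal.toReal_ofReal (cauchyDensity_pos _ _).le, smul_smul,
      abs_deriv_mul_cauchyDensity θ ht]
  rw [integrableOn_congr_fun h measurableSet_Ioo]
  exact integrable_smul_iff (c := (2 * π)⁻¹) (inv_ne_zero two_pi_pos.ne') _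

theorem integral_cauchyLaw (θ : UpperHalfPlane) (g : ℝ → ℝ) :
    ∫ x, g x ∂(cauchyLaw θ) = (2 * π)⁻¹ * ∫ t in Ioo 0 (2 * π), g (cauchyAngle θ t) := by
  rw [cauchyLaw_eq_withDensity_cauchyDensity, integral_withDensity_eq_integral_toReal_smul
    (measurable_cauchyDensity θ).ennreal_ofReal (by simp), ← setIntegral_univ,
    ← image_cauchyAngle θ, integral_image_eq_integral_abs_deriv_smul measurableSet_Ioo
      (fun t ht => (hasDerivAt_cauchyAngle θ ht).hasDerivWithinAt) (injOn_cauchyAngle θ),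
    ← integral_const_mul]
  refine setIntegral_congr_fun measurableSet_Ioo fun t ht => ?_
  rw [ENNReal.toReal_ofReal (cauchyDensity_pos _ _).le, smul_smul,
    abs_deriv_mul_cauchyDensity θ ht, smul_eq_mul]

/-- With `z = circleMap 0 1 t`, the point `cauchyAngle θ t` is the Möbius image `(conj θ * z - θ) /
(z - 1)`, which sends `0` to `θ` and `1` to `∞`. -/
theorem cauchyAngle_sub_mul (θ : UpperHalfPlane) (w : ℂ) {t : ℝ} (ht : t ∈ Ioo 0 (2 * π)) :
    ((cauchyAngle θ t : ℂ) - w) * (circleMap 0 1 t - 1)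
      = (conj (θ : ℂ) - w) * circleMap 0 1 t - ((θ : ℂ) - w) := by
  have hc := cos_pos_of_mem_Ioo (half_sub_half_pi_mem ht)
  set φ := t / 2 - π / 2 with hφ
  have hz : circleMap 0 1 t = -((cos φ : ℂ) + sin φ * Complex.I) ^ 2 := by
    have h1 : (t : ℂ) * Complex.I = (φ : ℂ) * Complex.I + φ * Complex.I + π * Complex.I := by
      rw [hφ]
      push_cast
      ring
    simp only [circleMap, zero_add, Complex.ofReal_one, one_mul]
    rw [h1, Complex.exp_add, Complex.exp_add, Complex.exp_pi_mul_I, Complex.exp_mul_I,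
      ← Complex.ofReal_cos, ← Complex.ofReal_sin]
    ring
  have hsc : (sin φ : ℂ) ^ 2 + (cos φ : ℂ) ^ 2 = 1 := by exact_mod_cast sin_sq_add_cos_sq φ
  have hc' : (cos φ : ℂ) ≠ 0 := by exact_mod_cast hc.ne'
  have hx : (cauchyAngle θ t : ℂ) = θ.re + θ.im * (sin φ / cos φ) := by
    rw [cauchyAngle, ← hφ, tan_eq_sin_div_cos]
    push_cast
    rfl
  have hθ : (θ : ℂ) = θ.re + θ.im * Complex.I := (Complex.re_add_im (θ : ℂ)).symm
  have hθ' : conj (θ : ℂ) = θ.re - θ.im * Complex.I := by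
    rw [hθ]
    simp [sub_eq_add_neg]
  rw [hz, hx, hθ', hθ]
  set c := (cos φ : ℂ)
  set s := (sin φ : ℂ)
  have hI := Complex.I_sq
  field_simp
  linear_combination (θ.im : ℂ) * (s - c * Complex.I) * hsc
    - θ.im * (s ^ 3 + c * s ^ 2 * Complex.I + 2 * c ^ 2 * s) * hI

/-! ### Inequalities for `log cosh` -/

/-- This is the sign of the derivative of `log (cosh t) / t ^ 2`. The difference of the two sides
vanishes at `0` and has derivative `(sinh t * cosh t - t) / cosh t ^ 2 ≥ 0`. -/
theorem two_mul_log_cosh_sub_mul_tanh_nonneg {t : ℝ} (ht : 0 ≤ t) :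
    t * (sinh t / cosh t) ≤ 2 * log (cosh t) := by
  let h : ℝ → ℝ := fun t => 2 * log (cosh t) - t * (sinh t / cosh t)
  have hd : ∀ t, HasDerivAt h (2 * (sinh t / cosh t)
      - (1 * (sinh t / cosh t) + t * ((cosh t * cosh t - sinh t * sinh t) / cosh t ^ 2))) t := by
    intro t
    have hc := (cosh_pos t).ne'
    exact (((hasDerivAt_cosh t).log hc).const_mul 2).sub
      ((hasDerivAt_id t).mul ((hasDerivAt_sinh t).div (hasDerivAt_cosh t) hc))
  have hm : MonotoneOn h (Ici 0) := by
    refine monotoneOn_of_deriv_nonneg (convex_Ici 0)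
      (fun t _ => (hd t).continuousAt.continuousWithinAt)
      (fun t _ => (hd t).differentiableAt.differentiableWithinAt) fun t ht => ?_
    rw [interior_Ici] at ht
    have h1 : t ≤ sinh t := self_le_sinh_iff.2 (le_of_lt ht)
    have h2 := one_le_cosh t
    have h3 := cosh_sq t
    rw [(hd t).deriv]
    have h4 : 2 * (sinh t / cosh t)
      - (1 * (sinh t / cosh t) + t * ((cosh t * cosh t - sinh t * sinh t) / cosh t ^ 2))
      = (sinh t * cosh t - t) / cosh t ^ 2 := by
      field_simp
      linear_combination (-t) * h3
    rw [h4]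
    have : 0 < t := ht
    exact div_nonneg (by nlinarith) (by positivity)
  have := hm (mem_Ici.2 le_rfl) (mem_Ici.2 ht) ht
  simp only [h, cosh_zero, log_one, sinh_zero] at this
  linarith

theorem antitoneOn_log_cosh_div_sq : AntitoneOn (fun t => log (cosh t) / t ^ 2) (Ioi 0) := by
  have hd : ∀ t ∈ Ioi (0 : ℝ), HasDerivAt (fun t => log (cosh t) / t ^ 2)
      ((sinh t / cosh t * t ^ 2 - log (cosh t) * (((2 : ℕ) : ℝ) * t ^ (2 - 1))) / (t ^ 2) ^ 2)
      t := by
    intro t ht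
    exact ((hasDerivAt_cosh t).log (cosh_pos t).ne').div (hasDerivAt_pow 2 t)
      (pow_ne_zero _ (ne_of_gt ht))
  refine antitoneOn_of_deriv_nonpos (convex_Ioi 0)
    (fun t ht => (hd t ht).continuousAt.continuousWithinAt)
    (fun t ht => (hd t (interior_subset ht)).differentiableAt.differentiableWithinAt)
    fun t ht => ?_
  rw [interior_Ioi] at ht
  rw [(hd t ht).deriv]
  have h0 : 0 < t := ht
  have h1 := two_mul_log_cosh_sub_mul_tanh_nonneg h0.le
  refine div_nonpos_of_nonpos_of_nonneg ?_ (by positivity)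
  norm_num
  nlinarith

theorem log_cosh_nonneg (t : ℝ) : 0 ≤ log (cosh t) := log_nonneg (one_le_cosh t)

/-- Monotonicity between `s` and `s + t`, after a square root. Adding the same bound with `s` and
`t` exchanged gives subadditivity, as the weights sum to `1`. -/
theorem div_add_mul_sqrt_log_cosh_le {s t : ℝ} (hs : 0 < s) (ht : 0 ≤ t) :
    s / (s + t) * √(log (cosh (s + t))) ≤ √(log (cosh s)) := by
  have hst : 0 < s + t := by linarith
  have h := antitoneOn_log_cosh_div_sq (mem_Ioi.2 hs) (mem_Ioi.2 hst) (by linarith)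
  simp only at h
  refine le_sqrt_of_sq_le ?_
  rw [mul_pow, sq_sqrt (log_cosh_nonneg _), div_pow]
  rw [div_le_div_iff₀ (by positivity) (by positivity)] at h
  rw [div_mul_eq_mul_div, div_le_iff₀ (by positivity)]
  linarith

theorem sqrt_log_cosh_add_le {s t : ℝ} (hs : 0 ≤ s) (ht : 0 ≤ t) :
    √(log (cosh (s + t))) ≤ √(log (cosh s)) + √(log (cosh t)) := by
  rcases hs.eq_or_lt with rfl | hs
  · simp
  rcases ht.eq_or_lt with rfl | ht
  · simp
  have h1 := div_add_mul_sqrt_log_cosh_le hs ht.le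
  have h2 := div_add_mul_sqrt_log_cosh_le ht hs.le
  rw [add_comm t s] at h2
  have h3 : s / (s + t) * √(log (cosh (s + t))) + t / (s + t) * √(log (cosh (s + t)))
      = √(log (cosh (s + t))) := by
    have : s + t ≠ 0 := by positivity
    field_simp
  linarith

theorem sqrt_log_cosh_le_add {r s t : ℝ} (hr : 0 ≤ r) (hs : 0 ≤ s) (ht : 0 ≤ t)
    (h : r ≤ s + t) : √(log (cosh r)) ≤ √(log (cosh s)) + √(log (cosh t)) := by
  refine le_trans (sqrt_le_sqrt (log_le_log (cosh_pos _) (cosh_le_cosh.2 ?_)))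
    (sqrt_log_cosh_add_le hs ht)
  rwa [abs_of_nonneg hr, abs_of_nonneg (by positivity)]

theorem two_mul_log_cosh_rpow_le_add {α : ℝ} (hα : 0 < α) (hα' : α ≤ 1 / 2) {r s t : ℝ}
    (hr : 0 ≤ r) (hs : 0 ≤ s) (ht : 0 ≤ t) (h : r ≤ s + t) :
    (2 * log (cosh r)) ^ α ≤ (2 * log (cosh s)) ^ α + (2 * log (cosh t)) ^ α := by
  -- The exponent `2 * α ≤ 1` makes `x ↦ x ^ (2 * α)` subadditive.
  have key : ∀ u, (2 * log (cosh u)) ^ α = 2 ^ α * √(log (cosh u)) ^ (2 * α) := by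
    intro u
    rw [mul_rpow two_pos.le (log_cosh_nonneg u), sqrt_eq_rpow, ← rpow_mul (log_cosh_nonneg u)]
    congr 2
    ring
  rw [key, key, key, ← mul_add]
  refine mul_le_mul_of_nonneg_left ?_ (by positivity)
  refine (rpow_le_rpow (sqrt_nonneg _) (sqrt_log_cosh_le_add hr hs ht h) (by linarith)).trans ?_
  exact rpow_add_le_add_rpow (sqrt_nonneg _) (sqrt_nonneg _) (by linarith) (by linarith)

/-- Above the exponent `1 / 2`, the triangle inequality fails for nearby points. -/
theorem exists_log_cosh_rpow_lt {α : ℝ} (hα : 1 / 2 < α) :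
    ∃ u : ℝ, 0 < u ∧ 2 * (2 * log (cosh u)) ^ α < (2 * log (cosh (2 * u))) ^ α := by
  -- With `x = sinh u ^ 2`, `e4` bounds the ratio of the two logarithms below by `4 / (1 + 2 * x)`,
  -- which tends to `4`; and `4 ^ α > 2` as `α > 1 / 2`.
  have hlim : Filter.Tendsto (fun u : ℝ => (4 / (1 + 2 * sinh u ^ 2)) ^ α)
      (nhdsWithin 0 (Ioi 0)) (nhds ((4 / (1 + 2 * sinh 0 ^ 2)) ^ α)) := by
    refine (ContinuousAt.tendsto ?_).mono_left nhdsWithin_le_nhds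
    refine ContinuousAt.rpow_const ?_ (Or.inl (by norm_num))
    refine ContinuousAt.div continuousAt_const ?_ (by norm_num)
    fun_prop
  have h2 : (2 : ℝ) < (4 / (1 + 2 * sinh 0 ^ 2)) ^ α := by
    have h4 : (4 : ℝ) ^ (1 / 2 : ℝ) = 2 := by
      rw [← sqrt_eq_rpow, show (4 : ℝ) = 2 ^ 2 by norm_num, sqrt_sq two_pos.le]
    simp only [sinh_zero]
    norm_num only
    calc (2 : ℝ) = 4 ^ (1 / 2 : ℝ) := h4.symm
      _ < 4 ^ α := rpow_lt_rpow_of_exponent_lt (by norm_num) hα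
  obtain ⟨u, hu, hu0⟩ := ((hlim.eventually_const_lt h2).and self_mem_nhdsWithin).exists
  have hu0 : 0 < u := hu0
  refine ⟨u, hu0, ?_⟩
  set x := sinh u ^ 2 with hx
  have hx0 : 0 < x := by
    have := sinh_pos_iff.2 hu0
    positivity
  have e1 : 2 * log (cosh u) = log (1 + x) := by
    rw [hx, ← cosh_sq', log_pow]
    norm_num
  have e2 : cosh (2 * u) = 1 + 2 * x := by
    rw [cosh_two_mul, cosh_sq', hx]
    ring
  have e3 : 0 < log (1 + x) := log_pos (by linarith)
  have e4 : 4 / (1 + 2 * x) * log (1 + x) ≤ 2 * log (1 + 2 * x) := by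
    have h5 : log (1 + x) ≤ x := by linarith [log_le_sub_one_of_pos (show 0 < 1 + x by linarith)]
    have h6 := one_sub_inv_le_log_of_pos (show 0 < 1 + 2 * x by linarith)
    calc 4 / (1 + 2 * x) * log (1 + x) ≤ 4 / (1 + 2 * x) * x := by gcongr
      _ = 2 * (1 - (1 + 2 * x)⁻¹) := by
        field_simp
        ring
      _ ≤ _ := by linarith
  rw [e1, e2]
  calc 2 * log (1 + x) ^ α < (4 / (1 + 2 * x)) ^ α * log (1 + x) ^ α := by gcongr
    _ = (4 / (1 + 2 * x) * log (1 + x)) ^ α := by rw [mul_rpow (by positivity) e3.le]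
    _ ≤ _ := by gcongr

/-! ### Poisson formula for `log |x - w|` -/

theorem conj_sub_coe_ne_zero (θ w : UpperHalfPlane) : conj (θ : ℂ) - (w : ℂ) ≠ 0 := by
  intro h
  have h1 := congrArg Complex.im h
  simp only [Complex.sub_im, Complex.conj_im, UpperHalfPlane.coe_im, Complex.zero_im] at h1
  linarith [θ.im_pos, w.im_pos]

theorem norm_sub_div_conj_sub_le_one (θ w : UpperHalfPlane) :
    ‖((θ : ℂ) - w) / (conj (θ : ℂ) - w)‖ ≤ 1 := by
  rw [norm_div, div_le_one (norm_pos_iff.2 (conj_sub_coe_ne_zero θ w))]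
  refine le_of_sq_le_sq ?_ (norm_nonneg _)
  rw [← Complex.normSq_eq_norm_sq, ← Complex.normSq_eq_norm_sq, Complex.normSq_apply,
    Complex.normSq_apply]
  simp only [Complex.sub_re, Complex.sub_im, Complex.conj_im, Complex.conj_re,
    UpperHalfPlane.coe_im, UpperHalfPlane.coe_re]
  nlinarith [mul_pos θ.im_pos w.im_pos]

theorem log_norm_cauchyAngle_sub (θ w : UpperHalfPlane) {t : ℝ} (ht : t ∈ Ioo 0 (2 * π)) :
    log ‖(cauchyAngle θ t : ℂ) - w‖ = log ‖conj (θ : ℂ) - w‖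
      + (log ‖circleMap 0 1 t - ((θ : ℂ) - w) / (conj (θ : ℂ) - w)‖
        - log ‖circleMap 0 1 t - 1‖) := by
  have hA := conj_sub_coe_ne_zero θ w
  have hx := coe_sub_ne_zero w (cauchyAngle θ t)
  have h := cauchyAngle_sub_mul θ w ht
  have h1 : (conj (θ : ℂ) - w) * circleMap 0 1 t - ((θ : ℂ) - w)
      = (conj (θ : ℂ) - w) * (circleMap 0 1 t - ((θ : ℂ) - w) / (conj (θ : ℂ) - w)) := by
    rw [mul_sub, mul_div_cancel₀ _ hA]
  have hz : circleMap 0 1 t - 1 ≠ 0 := by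
    intro hz
    rw [hz, sub_eq_zero.1 hz, mul_zero] at h
    have h2 := congrArg Complex.im h
    simp only [Complex.sub_im, Complex.conj_im, UpperHalfPlane.coe_im, Complex.zero_im,
      mul_one] at h2
    linarith [θ.im_pos]
  rw [h1] at h
  have hB := right_ne_zero_of_mul (h ▸ mul_ne_zero hx hz)
  have h2 := congrArg (fun z : ℂ => log ‖z‖) h
  simp only [norm_mul] at h2
  rw [log_mul (norm_ne_zero_iff.2 hx) (norm_ne_zero_iff.2 hz),
    log_mul (norm_ne_zero_iff.2 hA) (norm_ne_zero_iff.2 hB)] at h2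
  linarith

theorem integrableOn_circleMap {f : ℂ → ℝ} (hf : CircleIntegrable f 0 1) :
    IntegrableOn (fun t => f (circleMap 0 1 t)) (Ioo 0 (2 * π)) :=
  (intervalIntegrable_iff_integrableOn_Ioo_of_le two_pi_pos.le).1 hf

theorem integral_circleMap (f : ℂ → ℝ) :
    ∫ t in Ioo 0 (2 * π), f (circleMap 0 1 t) = 2 * π * circleAverage f 0 1 := by
  rw [circleAverage_def, smul_eq_mul, mul_inv_cancel_left₀ two_pi_pos.ne',
    intervalIntegral.integral_of_le two_pi_pos.le, integral_Ioc_eq_integral_Ioo]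

theorem integrable_log_norm_sub (θ w : UpperHalfPlane) :
    Integrable (fun x : ℝ => log ‖(x : ℂ) - w‖) (cauchyLaw θ) := by
  rw [integrable_cauchyLaw_iff, integrableOn_congr_fun
    (fun t ht => log_norm_cauchyAngle_sub θ w ht) measurableSet_Ioo]
  exact (integrableOn_const measure_Ioo_lt_top.ne).add
    ((integrableOn_circleMap (circleIntegrable_log_norm_sub_const 1)).sub
      (integrableOn_circleMap (circleIntegrable_log_norm_sub_const 1)))

/-- The Poisson formula for the function `log |· - w|`, harmonic in the lower half-plane. -/
theorem integral_log_norm_sub (θ w : UpperHalfPlane) :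
    ∫ x : ℝ, log ‖(x : ℂ) - w‖ ∂(cauchyLaw θ) = log ‖conj (θ : ℂ) - w‖ := by
  have hB := integrableOn_circleMap
    (circleIntegrable_log_norm_sub_const (a := ((θ : ℂ) - w) / (conj (θ : ℂ) - w)) (c := 0) 1)
  have h1 := integrableOn_circleMap (circleIntegrable_log_norm_sub_const (a := 1) (c := 0) 1)
  have hc : IntegrableOn (fun _ : ℝ => log ‖conj (θ : ℂ) - w‖) (Ioo 0 (2 * π)) :=
    integrableOn_const measure_Ioo_lt_top.ne
  have hp := posLog_eq_zero_iff (‖((θ : ℂ) - w) / (conj (θ : ℂ) - w)‖)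
  rw [integral_cauchyLaw, setIntegral_congr_fun measurableSet_Ioo
    (fun t ht => log_norm_cauchyAngle_sub θ w ht)]
  have e := integral_add hc (hB.sub h1)
  have e' := integral_sub hB h1
  simp only [Pi.sub_apply] at e
  -- The circle average of `log |z - a|` is `log⁺ |a|`, zero for both values of `a`.
  rw [e, e', integral_circleMap (fun z => log ‖z - ((θ : ℂ) - w) / (conj (θ : ℂ) - w)‖),
    integral_circleMap (fun z => log ‖z - 1‖), circleAverage_log_norm_sub_const_eq_posLog,
    circleAverage_log_norm_sub_const_eq_posLog,
    hp.2 (by rw [abs_norm]; exact norm_sub_div_conj_sub_le_one θ w)]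
  have := pi_pos
  simp [two_pi_pos.le]
  field_simp

/-! ### The divergence as a function of hyperbolic distance -/

theorem cauchyLaw_eq_withDensity_cauchyLaw (θ₁ θ₂ : UpperHalfPlane) :
    cauchyLaw θ₁ = (cauchyLaw θ₂).withDensity
      fun x => ENNReal.ofReal (cauchyDensity θ₁ x / cauchyDensity θ₂ x) := by
  have hm := ((measurable_cauchyDensity θ₁).div (measurable_cauchyDensity θ₂)).ennreal_ofReal
  simp only [Pi.div_apply] at hm
  rw [cauchyLaw_eq_withDensity_cauchyDensity θ₁, cauchyLaw_eq_withDensity_cauchyDensity θ₂,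
    ← withDensity_mul _ (measurable_cauchyDensity θ₂).ennreal_ofReal hm]
  congr 1
  funext x
  rw [Pi.mul_apply, ← ENNReal.ofReal_mul (cauchyDensity_pos θ₂ x).le,
    mul_div_cancel₀ _ (cauchyDensity_pos θ₂ x).ne']

theorem cauchyLaw_absolutelyContinuous (θ₁ θ₂ : UpperHalfPlane) :
    cauchyLaw θ₁ ≪ cauchyLaw θ₂ := by
  rw [cauchyLaw_eq_withDensity_cauchyLaw θ₁ θ₂]
  exact withDensity_absolutelyContinuous _ _

theorem log_cauchyDensity_div (θ₁ θ₂ : UpperHalfPlane) (x : ℝ) :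
    log (cauchyDensity θ₁ x / cauchyDensity θ₂ x)
      = log (θ₁.im / θ₂.im) + (2 * log ‖(x : ℂ) - θ₂‖ - 2 * log ‖(x : ℂ) - θ₁‖) := by
  have h1 := norm_pos_iff.2 (coe_sub_ne_zero θ₁ x)
  have h2 := norm_pos_iff.2 (coe_sub_ne_zero θ₂ x)
  have hs1 := θ₁.im_pos
  have hs2 := θ₂.im_pos
  have h3 : cauchyDensity θ₁ x / cauchyDensity θ₂ x
      = θ₁.im / θ₂.im * (‖(x : ℂ) - θ₂‖ ^ 2 / ‖(x : ℂ) - θ₁‖ ^ 2) := by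
    rw [cauchyDensity, cauchyDensity, abs_of_pos hs1, abs_of_pos hs2]
    have := pi_pos
    field_simp
  rw [h3, log_mul (by positivity) (by positivity), log_div (x := _ ^ 2) (by positivity) (by positivity),
    log_pow, log_pow]
  norm_num

theorem llr_cauchyLaw (θ₁ θ₂ : UpperHalfPlane) :
    llr (cauchyLaw θ₁) (cauchyLaw θ₂) =ᵐ[cauchyLaw θ₁]
      fun x => log (θ₁.im / θ₂.im) + (2 * log ‖(x : ℂ) - θ₂‖ - 2 * log ‖(x : ℂ) - θ₁‖) := by
  have h := Measure.rnDeriv_withDensity (cauchyLaw θ₂)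
    ((measurable_cauchyDensity θ₁).div (measurable_cauchyDensity θ₂)).ennreal_ofReal
  simp only [Pi.div_apply] at h
  rw [← cauchyLaw_eq_withDensity_cauchyLaw] at h
  filter_upwards [(cauchyLaw_absolutelyContinuous θ₁ θ₂).ae_le h] with x hx
  simp only [llr_def]
  rw [hx, ENNReal.toReal_ofReal
    (div_nonneg (cauchyDensity_pos θ₁ x).le (cauchyDensity_pos θ₂ x).le),
    log_cauchyDensity_div]

theorem integrable_llr_cauchyLaw (θ₁ θ₂ : UpperHalfPlane) :
    Integrable (llr (cauchyLaw θ₁) (cauchyLaw θ₂)) (cauchyLaw θ₁) := by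
  rw [integrable_congr (llr_cauchyLaw θ₁ θ₂)]
  exact (integrable_const _).add (((integrable_log_norm_sub θ₁ θ₂).const_mul 2).sub
    ((integrable_log_norm_sub θ₁ θ₁).const_mul 2))

/-- The Kullback-Leibler divergence of Cauchy laws in terms of the hyperbolic distance. -/
theorem toReal_cauchyKL (θ₁ θ₂ : UpperHalfPlane) :
    (cauchyKL θ₁ θ₂).toReal = 2 * log (cosh (dist θ₁ θ₂ / 2)) := by
  have h2 := (integrable_log_norm_sub θ₁ θ₂).const_mul 2
  have h1 := (integrable_log_norm_sub θ₁ θ₁).const_mul 2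
  have e := integral_add (integrable_const (log (θ₁.im / θ₂.im))) (h2.sub h1)
  have e' := integral_sub h2 h1
  simp only [Pi.sub_apply] at e
  have hs1 := θ₁.im_pos
  have hs2 := θ₂.im_pos
  have h3 : ‖conj (θ₁ : ℂ) - θ₁‖ = 2 * θ₁.im := by
    rw [← dist_eq_norm, Complex.dist_conj_self, UpperHalfPlane.coe_im, abs_of_pos hs1]
  have h4 := norm_pos_iff.2 (conj_sub_coe_ne_zero θ₁ θ₂)
  -- The integral is the logarithm of `|conj θ₁ - θ₂| ^ 2 / (4 * θ₁.im * θ₂.im)`, which is `cosh (d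
  -- / 2) ^ 2`.
  rw [cauchyKL, InformationTheory.toReal_klDiv_of_measure_eq
    (cauchyLaw_absolutelyContinuous θ₁ θ₂) (by simp), integral_congr_ae (llr_cauchyLaw θ₁ θ₂),
    e, e', integral_const_mul, integral_const_mul, integral_log_norm_sub, integral_log_norm_sub,
    h3, UpperHalfPlane.cosh_half_dist, ← Complex.dist_conj_comm, dist_eq_norm]
  rw [log_div h4.ne' (by positivity), log_mul two_ne_zero hs1.ne',
    log_mul two_ne_zero (by positivity), log_sqrt (by positivity), log_mul hs1.ne' hs2.ne',
    log_div hs1.ne' hs2.ne']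
  simp
  ring

theorem cauchyKL_ne_top (θ₁ θ₂ : UpperHalfPlane) : cauchyKL θ₁ θ₂ ≠ ⊤ :=
  InformationTheory.klDiv_ne_top (cauchyLaw_absolutelyContinuous θ₁ θ₂)
    (integrable_llr_cauchyLaw θ₁ θ₂)

/-! ### The metric property and its failure -/

theorem isMetricOn_cauchyKL_rpow {α : ℝ} (hα : 0 < α) (hα' : α ≤ 1 / 2) :
    IsMetricOn fun θ₁ θ₂ : UpperHalfPlane => (cauchyKL θ₁ θ₂).toReal ^ α := by
  simp only [toReal_cauchyKL]
  refine ⟨{ dist := fun θ₁ θ₂ => (2 * log (cosh (dist θ₁ θ₂ / 2))) ^ α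
            dist_self := fun θ => by simp [hα.ne']
            dist_comm := fun θ₁ θ₂ => by rw [dist_comm]
            dist_triangle := fun θ₁ θ₂ θ₃ => ?_
            eq_of_dist_eq_zero := fun {θ₁ θ₂} h => ?_ }, fun _ _ => rfl⟩
  · exact two_mul_log_cosh_rpow_le_add hα hα' (by positivity) (by positivity) (by positivity)
      (by linarith [dist_triangle θ₁ θ₂ θ₃])
  · by_contra hne
    have hd : dist θ₁ θ₂ / 2 ≠ 0 := by simpa using hne
    have h0 := log_pos (one_lt_cosh.2 hd)
    exact (rpow_pos_of_pos (mul_pos two_pos h0) α).ne' h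

/-- Arc-length parametrization of the imaginary axis, a geodesic. -/
theorem dist_mk_exp (a b : ℝ) :
    dist (⟨⟨0, exp a⟩, exp_pos a⟩ : UpperHalfPlane) ⟨⟨0, exp b⟩, exp_pos b⟩ = |a - b| := by
  have h : (⟨⟨0, exp a⟩, exp_pos a⟩ : UpperHalfPlane).re
      = (⟨⟨0, exp b⟩, exp_pos b⟩ : UpperHalfPlane).re := rfl
  rw [UpperHalfPlane.dist_of_re_eq h]
  simp [UpperHalfPlane.im, Real.dist_eq]

theorem mainTheorem3 (α : ℝ) (hα : 0 < α) (hα' : α ≤ 1) :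
    (∀ θ₁ θ₂ : UpperHalfPlane, cauchyKL θ₁ θ₂ ≠ ⊤) ∧
      (IsMetricOn (fun θ₁ θ₂ : UpperHalfPlane => (cauchyKL θ₁ θ₂).toReal ^ α) ↔
        α ≤ 1 / 2) := by
  refine ⟨cauchyKL_ne_top, fun ⟨m, hm⟩ => ?_, isMetricOn_cauchyKL_rpow hα⟩
  by_contra! h
  obtain ⟨u, hu, hlt⟩ := exists_log_cosh_rpow_lt h
  let p : ℝ → UpperHalfPlane := fun a => ⟨⟨0, exp a⟩, exp_pos a⟩
  have hp : ∀ a b, m.dist (p a) (p b) = (2 * log (cosh (|a - b| / 2))) ^ α := fun a b => by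
    rw [hm]
    simp only [p]
    rw [toReal_cauchyKL, dist_mk_exp]
  -- Spacing `2 * u` gives half-distances `u`, `u` and `2 * u`, as in `hlt`.
  have h3 := m.dist_triangle (p (4 * u)) (p (2 * u)) (p 0)
  rw [hp, hp, hp, abs_of_pos (by linarith), abs_of_pos (by linarith), abs_of_pos (by linarith),
    show (4 * u - 0) / 2 = 2 * u by ring, show (4 * u - 2 * u) / 2 = u by ring,
    show (2 * u - 0) / 2 = u by ring] at h3
  linarith
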